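/- For integers $p,n\ge 1$ let $\mathbb{T}_{p,n}$ be the set of real tensors $\mathcal A=(a_{i_1\ldots i_p})_{1\le i_1,\ldots,i_p\le n}$ of order $p$ and dimension $n$. For $\mathcal A\in\mathbb{T}_{p,n}$ and $x\in\mathbb{R}^n$ put $(\mathcal A x^{p-1})_i=\sum_{i_2,\ldots,i_p=1}^n a_{ii_2\ldots i_p}x_{i_2}\cdots x_{i_p}$ and $\|\mathcal A\|_\infty=\max_{1\le i\le n}\sum_{i_2,\ldots,i_p=1}^n|a_{ii_2\ldots i_p}|$, and let $|x|$ be the vector of componentwise absolute values. The majorization matrix $M(\mathcal A)$ is the $n\times n$ matrix with entries $M(\mathcal A)_{ij}=a_{ij\ldots j}$. For $\mathcal A\in\mathbb{T}_{p,n}$ with $p\ge 2$ and $\mathcal B\in\mathbb{T}_{q,n}$, the product $\mathcal A\cdot\mathcal B$ is the tensor of order $(p-1)(q-1)+1$ and dimension $n$ with entries $$(\mathcal A\cdot\mathcal B)_{ij_1\ldots j_{p-1}}=\sum_{i_2,\ldots,i_p=1}^n a_{ii_2\ldots i_p}\,b_{i_2j_1}\cdots b_{i_pj_{p-1}},\qquad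 i\in\{1,\ldots,n\},\ j_1,\ldots,j_{p-1}\in\{1,\ldots,n\}^{q-1}.$$ In particular, for an $n\times n$ matrix $Q$ (a tensor of order $2$), $Q\cdot\mathcal B\in\mathbb{T}_{q,n}$; $Q$ is called an order $2$ left inverse of $\mathcal B$ if $Q\cdot\mathcal B=\mathcal I$, where $\mathcal I\in\mathbb{T}_{q,n}$ is the unit tensor, whose entry is $1$ when all indices are equal and $0$ otherwise. \textbf{Theorem.} Let $p\ge 2$ be even and let $\mathcal A,\mathcal B\in\mathbb{T}_{p,n}$. Suppose that $M(\mathcal A)$ is nonsingular and that $M(\mathcal A)^{-1}$ is the unique order $2$ left inverse of $\mathcal A$. If $\|M(\mathcal A)^{-1}\cdot\mathcal B\|_\infty<1$, then for every $b\in\mathbb{R}^n$ the equation $$\mathcal A x^{p-1}+\mathcal B|x|^{p-1}=b$$ has at least one solution $x\in\mathbb{R}^n$. -/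

import Mathlib

/-- Real square tensors of order `p` and dimension `n`: the entry `a_{i₁ i₂ … i_p}` of `A` is
`A ![i₁, i₂, …, i_p]`. -/
abbrev SquareTensor (p n : ℕ) : Type := (Fin p → Fin n) → ℝ

namespace SquareTensor

variable {m k n : ℕ}

/-- For a tensor `A` of order `p = m + 1`, the vector `A x^{p-1}` whose `i`-th component is
`∑_{i₂, …, i_p} a_{i i₂ … i_p} x_{i₂} ⋯ x_{i_p}`. -/
def apply (A : SquareTensor (m + 1) n) (x : Fin n → ℝ) : Fin n → ℝ :=
  fun i => ∑ j : Fin m → Fin n, A (Fin.cons i j : Fin (m + 1) → Fin n) * ∏ t, x (j t)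

/-- The `∞`-norm `max_i ∑_{i₂, …, i_p} |a_{i i₂ … i_p}|`. -/
noncomputable def inftyNorm (A : SquareTensor (m + 1) n) : ℝ :=
  ⨆ i : Fin n, ∑ j : Fin m → Fin n, |A (Fin.cons i j : Fin (m + 1) → Fin n)|

/-- The unit tensor of order `p` and dimension `n`: the entry is `1` if all `p` indices are equal
and `0` otherwise. -/
def unit (p n : ℕ) : SquareTensor p n :=
  fun i => if ∀ s t, i s = i t then 1 else 0

/-- The general (Shao) product `A · B` of a tensor of order `p = m + 1` and a tensor of order
`q = k + 1`. It has order `(p - 1) * (q - 1) + 1 = m * k + 1`, and its entry at `i j₁ … j_{p-1}`,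
where each `j_t` is a block of `q - 1 = k` indices, is
`∑_{i₂, …, i_p} a_{i i₂ … i_p} b_{i₂ j₁} ⋯ b_{i_p j_{p-1}}`.
(`finProdFinEquiv (t, s)` is the position `s + k * t`, that is, place `s` of block `t`.) -/
def prod (A : SquareTensor (m + 1) n) (B : SquareTensor (k + 1) n) :
    SquareTensor (m * k + 1) n :=
  fun idx => ∑ l : Fin m → Fin n,
    A (Fin.cons (idx 0) l : Fin (m + 1) → Fin n) *
      ∏ t : Fin m,
        B (Fin.cons (l t) (fun s : Fin k => idx (finProdFinEquiv (t, s)).succ) :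
          Fin (k + 1) → Fin n)

/-- `Q` is an (order `m + 1`) left inverse of `A`: the product `Q · A` is the unit tensor. -/
def IsLeftInverse (Q : SquareTensor (m + 1) n) (A : SquareTensor (k + 1) n) : Prop :=
  prod Q A = unit (m * k + 1) n

/-- `Q` is the unique left inverse of `A` among the tensors of the order of `Q`. -/
def IsUniqueLeftInverse (Q : SquareTensor (m + 1) n) (A : SquareTensor (k + 1) n) : Prop :=
  IsLeftInverse Q A ∧ ∀ Q' : SquareTensor (m + 1) n, IsLeftInverse Q' A → Q' = Q

/-- An `n × n` matrix as a tensor of order `2`. -/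
def ofMatrix (Q : Matrix (Fin n) (Fin n) ℝ) : SquareTensor (1 + 1) n :=
  fun i => Q (i 0) (i 1)

/-- The majorization matrix `M(A)`, with entries `M(A)_{ij} = a_{i j … j}`. -/
def majorization (A : SquareTensor (m + 1) n) : Matrix (Fin n) (Fin n) ℝ :=
  Matrix.of fun i j => A (Fin.cons i (fun _ => j) : Fin (m + 1) → Fin n)

end SquareTensor

/-! Multiplying by `M⁻¹` turns `A x^{p-1}` into the vector of powers `x_i ^ k`, `k = p - 1` odd, so
with `C = M⁻¹ · B`, `c = M⁻¹ b` the equation reads `x_i ^ k + (C |x|^k)_i = c_i`. In the unknown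
`y_i = x_i ^ k`, a bijective change of variable, this is a fixed point problem for a continuous map
whose nonlinear part has sup norm at most `‖C‖_∞ ‖y‖`. As `‖C‖_∞ < 1`, a large cube is mapped into
itself and Brouwer applies.

Brouwer's theorem is proved by the Milnor–Rogers volume argument. For a `C¹` retraction `r` onto the
sphere and `g = r - id`, the integral of `det (1 + t Dg)` over the ball is polynomial in `t` and
equals the volume for small `t`, hence also at `t = 1`, where the integrand is `det Dr = 0`. -/

/-! ### Brouwer's fixed point theorem. -/

open Polynomial in
-- `det (1 + t A)` is a polynomial in `t` of degree at most the dimension; interpolation carries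
-- information from small `t` to `t = 1`.
theorem LinearMap.det_one_add_eq_sum_lagrange {E : Type*} [AddCommGroup E] [Module ℝ E]
    [FiniteDimensional ℝ E] {ι : Type*} [DecidableEq ι] {s : Finset ι} {v : ι → ℝ}
    (hv : Set.InjOn v s) (hs : Module.finrank ℝ E < s.card) (A : E →ₗ[ℝ] E) :
    LinearMap.det (1 + A) =
      ∑ i ∈ s, LinearMap.det (1 + v i • A) * (Lagrange.basis s v i).eval 1 := by
  let b := Module.finBasis ℝ E
  let N := LinearMap.toMatrix b b A
  let P : ℝ[X] := ((X : ℝ[X]) • N.map C + (1 : Matrix (Fin _) (Fin _) ℝ).map C).det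
  have hP : ∀ t : ℝ, P.eval t = LinearMap.det (1 + t • A) := by
    intro t
    rw [← LinearMap.det_toMatrix b, ← Polynomial.coe_evalRingHom, RingHom.map_det]
    congr 1
    ext i j
    simp only [RingHom.mapMatrix_apply, Matrix.map_apply, Matrix.add_apply, Matrix.smul_apply, map_add,
      LinearMap.toMatrix_one, map_smul]
    simp [N, add_comm]
    exact mul_comm _ _
  have hdeg : P.degree < s.card := by
    refine (Polynomial.degree_le_natDegree).trans_lt ?_
    have := Polynomial.natDegree_det_X_add_C_le N 1
    rw [Fintype.card_fin] at this
    exact_mod_cast this.trans_lt hs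
  have h := congrArg (Polynomial.eval 1) (Lagrange.eq_interpolate hv hdeg)
  rw [hP, one_smul, Lagrange.interpolate_apply, Polynomial.eval_finsetSum] at h
  simpa [hP] using h

open Metric

theorem exists_mem_sphere_dist_le {E : Type*} [NormedAddCommGroup E] [NormedSpace ℝ E] {R : ℝ}
    {x y : E} (hx : ‖x‖ ≤ R) (hy : R ≤ ‖y‖) : ∃ z ∈ sphere (0 : E) R, dist x z ≤ dist x y := by
  obtain ⟨z, hz, hzR⟩ := (convex_segment x y).isPreconnected.intermediate_value
    (left_mem_segment ℝ x y) (right_mem_segment ℝ x y) (continuous_norm.continuousOn) ⟨hx, hy⟩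
  refine ⟨z, by simpa using hzR, ?_⟩
  have := dist_add_dist_of_mem_segment hz
  linarith [dist_nonneg (x := z) (y := y)]

/-- A segment leaving the ball meets the sphere, where `g` vanishes, so extension by zero does not
increase the Lipschitz constant. -/
theorem LipschitzOnWith.indicator_closedBall {E F : Type*} [NormedAddCommGroup E]
    [NormedSpace ℝ E] [NormedAddCommGroup F] {R : ℝ} {K : NNReal} {g : E → F}
    (hg : LipschitzOnWith K g (closedBall 0 R)) (h0 : ∀ x ∈ sphere (0 : E) R, g x = 0) :
    LipschitzWith K ((closedBall (0 : E) R).indicator g) := by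
  have key : ∀ x ∈ closedBall (0 : E) R, ∀ y ∉ closedBall (0 : E) R,
      dist (g x) 0 ≤ K * dist x y := by
    intro x hx y hy
    obtain ⟨z, hz, hxz⟩ := exists_mem_sphere_dist_le (R := R) (by simpa using hx)
      (by simpa using (not_le.mp (by simpa using hy)).le)
    rw [← h0 z hz]
    exact (hg.dist_le_mul x hx z (sphere_subset_closedBall hz)).trans (by gcongr)
  refine LipschitzWith.of_dist_le_mul fun x y => ?_
  by_cases hx : x ∈ closedBall (0 : E) R <;> by_cases hy : y ∈ closedBall (0 : E) R
  · simpa [Set.indicator_of_mem hx, Set.indicator_of_mem hy] using hg.dist_le_mul x hx y hy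
  · rw [Set.indicator_of_mem hx, Set.indicator_of_notMem hy]
    exact key x hx y hy
  · rw [Set.indicator_of_notMem hx, Set.indicator_of_mem hy, dist_comm, dist_comm x]
    exact key y hy x hx
  · rw [Set.indicator_of_notMem hx, Set.indicator_of_notMem hy, dist_self]
    positivity

/-- With `G` the extension of `g` by zero, preimages of `y` under `id + t G` are the fixed points of
the contraction `x ↦ y - t G x`. -/
theorem bijOn_closedBall_id_add_smul {E : Type*} [NormedAddCommGroup E] [NormedSpace ℝ E]
    [CompleteSpace E] {R : ℝ} {K : NNReal} {g : E → E}
    (hg : LipschitzOnWith K g (closedBall 0 R)) (h0 : ∀ x ∈ sphere (0 : E) R, g x = 0)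
    {t : NNReal} (ht : t * K < 1) :
    Set.BijOn (fun x => x + (t : ℝ) • g x) (closedBall 0 R) (closedBall 0 R) := by
  set G := (closedBall (0 : E) R).indicator g with hG
  have hGl : LipschitzWith K G := hg.indicator_closedBall h0
  have hin : ∀ x ∈ closedBall (0 : E) R, G x = g x := fun x hx => Set.indicator_of_mem hx g
  have hout : ∀ x ∉ closedBall (0 : E) R, G x = 0 := fun x hx => Set.indicator_of_notMem hx g
  have hcontr : ∀ y, ContractingWith (t * K) (fun x => y - (t : ℝ) • G x) := fun y => by
    refine ⟨ht, LipschitzWith.of_dist_le_mul fun a b => ?_⟩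
    rw [dist_sub_left, dist_smul₀, NNReal.coe_mul, mul_assoc]
    simp only [NNReal.norm_eq]
    gcongr
    exact hGl.dist_le_mul a b
  have hinj : ∀ a b, a + (t : ℝ) • G a = b + (t : ℝ) • G b → a = b := fun a b hab =>
    (hcontr (a + (t : ℝ) • G a)).fixedPoint_unique' (by simp [Function.IsFixedPt])
      (by simp [Function.IsFixedPt, hab])
  refine ⟨fun x hx => ?_, fun a ha b hb hab => ?_, fun y hy => ?_⟩
  -- An image point outside the ball would be its own image under `id + t G`, hence equal to `x` by
  -- injectivity.
  · by_contra hy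
    have hxy := hinj x (x + (t : ℝ) • g x) (by rw [hout _ hy, hin x hx, smul_zero, add_zero])
    apply hy
    change x + (t : ℝ) • g x ∈ _
    rwa [← hxy]
  · exact hinj a b (by simpa [hin a ha, hin b hb] using hab)
  · obtain ⟨x, hx⟩ : ∃ x, y - (t : ℝ) • G x = x :=
      ⟨_, (hcontr y).fixedPoint_isFixedPt⟩
    have hxB : x ∈ closedBall (0 : E) R := by
      by_contra hxn
      rw [hout x hxn, smul_zero, sub_zero] at hx
      exact hxn (hx ▸ hy)
    refine ⟨x, hxB, ?_⟩
    rw [hin x hxB] at hx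
    simpa using (sub_eq_iff_eq_add.mp hx).symm

section NoRetraction

variable {E : Type*} [NormedAddCommGroup E] [InnerProductSpace ℝ E] [FiniteDimensional ℝ E]

/-- Differentiating `‖r‖² = R²` shows that the range of the derivative is orthogonal to `r x ≠ 0`.
-/
theorem det_fderiv_eq_zero_of_norm_eq {r : E → E} {R : ℝ} (hR : 0 < R) {x : E}
    (hd : DifferentiableAt ℝ r x) (hr : ∀ x, ‖r x‖ = R) : (fderiv ℝ r x).det = 0 := by
  by_contra h
  have hunit : IsUnit (fderiv ℝ r x : E →ₗ[ℝ] E) :=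
    (LinearMap.isUnit_iff_isUnit_det _).2 (isUnit_iff_ne_zero.2 h)
  obtain ⟨v, hv⟩ := LinearMap.range_eq_top.1 ((LinearMap.isUnit_iff_range_eq_top _).1 hunit) (r x)
  have h1 := hd.hasFDerivAt.norm_sq
  simp only [hr] at h1
  have h2 := DFunLike.congr_fun (h1.unique (hasFDerivAt_const _ x)) v
  have hv' : fderiv ℝ r x v = r x := hv
  simp [hv', hr, hR.ne'] at h2

variable [MeasurableSpace E] [BorelSpace E]

open MeasureTheory in
theorem setIntegral_det_one_add_smul_fderiv {g : E → E} (hg : ContDiff ℝ 1 g) {R : ℝ}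
    {K : NNReal} (hK : LipschitzOnWith K g (closedBall 0 R))
    (h0 : ∀ x ∈ sphere (0 : E) R, g x = 0) {t : ℝ} (ht0 : 0 ≤ t) (ht : t * K < 1)
    (hpos : ∀ x ∈ closedBall (0 : E) R, 0 < (1 + t • fderiv ℝ g x).det) :
    ∫ x in closedBall (0 : E) R, (1 + t • fderiv ℝ g x).det =
      volume.real (closedBall (0 : E) R) := by
  have hb : Set.BijOn (fun x => x + t • g x) (closedBall 0 R) (closedBall 0 R) := by
    lift t to NNReal using ht0
    exact bijOn_closedBall_id_add_smul hK h0 (by exact_mod_cast ht)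
  have hder : ∀ x ∈ closedBall (0 : E) R, HasFDerivWithinAt (fun x => x + t • g x)
      (1 + t • fderiv ℝ g x) (closedBall 0 R) x := fun x _ =>
    ((hasFDerivAt_id x).add
      ((hg.differentiable (by norm_num) x).hasFDerivAt.const_smul t)).hasFDerivWithinAt
  have := integral_image_eq_integral_abs_det_fderiv_smul volume measurableSet_closedBall hder
    hb.injOn (fun _ => (1 : ℝ))
  rw [hb.image_eq] at this
  simp only [smul_eq_mul, mul_one, integral_const, MeasurableSet.univ, measureReal_restrict_apply,
    Set.univ_inter] at this
  rw [this]
  exact setIntegral_congr_fun measurableSet_closedBall fun x hx => (abs_of_pos (hpos x hx)).symm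

open MeasureTheory in
/-- There is no `C¹` retraction of a closed ball onto its boundary sphere. -/
theorem not_exists_contDiff_retraction_sphere {r : E → E} (hr : ContDiff ℝ 1 r) {R : ℝ}
    (hR : 0 < R) (hnorm : ∀ x, ‖r x‖ = R) (hid : ∀ x ∈ sphere (0 : E) R, r x = x) : False := by
  set g : E → E := fun x => r x - x with hgdef
  have hg : ContDiff ℝ 1 g := hr.sub contDiff_id
  have hg0 : ∀ x ∈ sphere (0 : E) R, g x = 0 := fun x hx => sub_eq_zero.2 (hid x hx)
  have hcomp : IsCompact (closedBall (0 : E) R) := isCompact_closedBall 0 R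
  obtain ⟨K, hK⟩ := hg.contDiffOn.exists_lipschitzOnWith one_ne_zero (convex_closedBall 0 R) hcomp
  have hcont : Continuous (fderiv ℝ g) := hg.continuous_fderiv (by norm_num)
  obtain ⟨L, hL⟩ := hcomp.exists_bound_of_continuousOn hcont.continuousOn
  obtain ⟨δ, hδ, hdet⟩ : ∃ δ > 0, ∀ S : E →L[ℝ] E, dist S 1 < δ → 0 < S.det := by
    have h1 : (1 : E →L[ℝ] E).det = 1 := LinearMap.det_id
    exact Metric.eventually_nhds_iff.1
      (ContinuousLinearMap.continuous_det.continuousAt.eventually_const_lt (by simp [h1]))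
  -- For `t ≤ τ`, `t g` is a contraction on the ball and `det (1 + t Dg)` stays positive there.
  obtain ⟨τ, hτ, hτK, hτL⟩ : ∃ τ : ℝ, 0 < τ ∧ τ * K < 1 ∧ τ * |L| < δ := by
    have hd : 0 < K + |L| / δ + 1 := by positivity
    refine ⟨1 / (K + |L| / δ + 1), by positivity, ?_, ?_⟩
    · rw [div_mul_eq_mul_div, div_lt_one hd]
      have : 0 ≤ |L| / δ := by positivity
      linarith
    · rw [div_mul_eq_mul_div, div_lt_iff₀ hd]
      have h1 : |L| / δ * δ = |L| := div_mul_cancel₀ _ hδ.ne'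
      nlinarith [K.coe_nonneg, mul_nonneg K.coe_nonneg hδ.le]
  set d := Module.finrank ℝ E
  let v : ℕ → ℝ := fun i => τ * (i / (d + 1))
  have hv0 : ∀ i, 0 ≤ v i := fun i => by positivity
  have hvτ : ∀ i ∈ Finset.range (d + 1), v i ≤ τ := fun i hi => by
    refine mul_le_of_le_one_right hτ.le ((div_le_one (by positivity)).2 ?_)
    exact_mod_cast (Finset.mem_range.1 hi).le
  have hvinj : Set.InjOn v (Finset.range (d + 1)) := fun i _ j _ hij => by
    have h1 : ((d : ℝ) + 1) ≠ 0 := by positivity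
    have := mul_left_cancel₀ hτ.ne' hij
    rw [div_left_inj' h1] at this
    exact_mod_cast this
  have hint : ∀ i ∈ Finset.range (d + 1),
      ∫ x in closedBall (0 : E) R, (1 + v i • fderiv ℝ g x).det =
        volume.real (closedBall (0 : E) R) := by
    intro i hi
    refine setIntegral_det_one_add_smul_fderiv hg hK hg0 (hv0 i) ?_ ?_
    · exact (mul_le_mul_of_nonneg_right (hvτ i hi) K.coe_nonneg).trans_lt hτK
    · intro x hx
      refine hdet _ ?_
      rw [dist_eq_norm, add_sub_cancel_left, norm_smul, Real.norm_of_nonneg (hv0 i)]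
      refine lt_of_le_of_lt ?_ hτL
      exact mul_le_mul (hvτ i hi) ((hL x hx).trans (le_abs_self L)) (norm_nonneg _) hτ.le
  have hzero : ∀ x, (1 + fderiv ℝ g x).det = 0 := fun x => by
    have hdr := hr.differentiable (by norm_num) x
    rw [← det_fderiv_eq_zero_of_norm_eq hR hdr hnorm]
    congr 1
    rw [hgdef, fderiv_fun_sub hdr differentiableAt_fun_id, fderiv_fun_id]
    exact add_sub_cancel _ _
  have hsum : ∫ x in closedBall (0 : E) R, (1 + fderiv ℝ g x).det =
      ∑ i ∈ Finset.range (d + 1), volume.real (closedBall (0 : E) R) *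
        (Lagrange.basis (Finset.range (d + 1)) v i).eval 1 := by
    have hpt : ∀ x, (1 + fderiv ℝ g x).det = ∑ i ∈ Finset.range (d + 1),
        (1 + v i • fderiv ℝ g x).det * (Lagrange.basis (Finset.range (d + 1)) v i).eval 1 :=
      fun x => LinearMap.det_one_add_eq_sum_lagrange hvinj (by simp [d]) _
    simp_rw [hpt]
    rw [integral_finsetSum]
    · refine Finset.sum_congr rfl fun i hi => ?_
      rw [integral_mul_const, hint i hi]
    · intro i _
      have hc : Continuous fun x => (1 + v i • fderiv ℝ g x).det :=
        ContinuousLinearMap.continuous_det.comp (continuous_const.add (hcont.const_smul (v i)))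
      exact (hc.continuousOn.integrableOn_compact hcomp).integrable.mul_const _
  -- The Lagrange basis sums to `1`, so the integral at `t = 1` is the volume of the ball.
  rw [← Finset.mul_sum, ← Polynomial.eval_finsetSum,
    Lagrange.sum_basis hvinj (by simp), Polynomial.eval_one, mul_one] at hsum
  simp only [hzero, integral_zero] at hsum
  have : 0 < volume.real (closedBall (0 : E) R) :=
    ENNReal.toReal_pos (measure_closedBall_pos _ _ hR).ne' hcomp.measure_lt_top.ne
  exact this.ne hsum

/-- Without a fixed point, `x - h x` rescaled to norm `R` would be a retraction, since `h` vanishes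
on the sphere. -/
theorem exists_fixedPoint_of_contDiff {h : E → E} (hh : ContDiff ℝ 1 h) {R : ℝ} (hR : 0 < R)
    (h0 : ∀ x, R ≤ ‖x‖ → h x = 0) : ∃ x, h x = x := by
  by_contra! hne
  have hne' : ∀ x, x - h x ≠ 0 := fun x hx => hne x (sub_eq_zero.1 hx).symm
  have hs : ContDiff ℝ 1 fun x => x - h x := contDiff_id.sub hh
  refine not_exists_contDiff_retraction_sphere (r := fun x => (R / ‖x - h x‖) • (x - h x))
    ((contDiff_const.div (hs.norm ℝ hne') fun x => norm_ne_zero_iff.2 (hne' x)).smul hs) hR ?_ ?_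
  · intro x
    rw [norm_smul, norm_div, norm_norm, div_mul_cancel₀ _ (norm_ne_zero_iff.2 (hne' x)),
      Real.norm_of_nonneg hR.le]
  · intro x hx
    have hx' : ‖x‖ = R := by simpa using hx
    simp [h0 x hx'.ge, hx', hR.ne']

/-- Brouwer's fixed point theorem for bounded continuous self-maps. -/
theorem exists_fixedPoint_of_continuous_of_bounded {H : E → E} (hH : Continuous H) {K : ℝ}
    (hK : ∀ x, ‖H x‖ ≤ K) : ∃ x, H x = x := by
  by_contra! hne
  have hK0 : 0 ≤ K := (norm_nonneg _).trans (hK 0)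
  have hcont : Continuous fun x => dist (H x) x := hH.dist continuous_id
  obtain ⟨x₀, -, hx₀⟩ := (isCompact_closedBall (0 : E) (K + 1)).exists_isMinOn
    ⟨0, by simpa using by linarith⟩ hcont.continuousOn
  set δ := dist (H x₀) x₀
  have hδ : 0 < δ := dist_pos.2 (hne x₀)
  let χ : E → ℝ := fun x => max 0 (min 1 (K + 2 - ‖x‖))
  have hχ : Continuous χ := by fun_prop
  have hχ0 : ∀ x, 0 ≤ χ x := fun x => le_max_left _ _
  have hχ1 : ∀ x, χ x ≤ 1 := fun x => max_le zero_le_one (min_le_left _ _)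
  -- Error below `1` keeps a fixed point of `h` in the ball of radius `K + 1`, where `χ = 1`; error
  -- below `δ` then contradicts the minimality of `δ`.
  obtain ⟨h, hh, happ, hsupp⟩ := (hχ.smul hH).exists_contDiff_approx 1
    (continuous_const (y := min 1 δ)) (fun _ => lt_min one_pos hδ)
  obtain ⟨x, hx⟩ := exists_fixedPoint_of_contDiff (R := K + 2) hh (by linarith) fun x hx => by
    by_contra hhx
    refine hsupp hhx ?_
    have : χ x = 0 := max_eq_left ((min_le_right _ _).trans (by linarith))
    simp [this]
  have hd := happ x
  rw [hx] at hd
  have hxK : ‖x‖ ≤ K + 1 := by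
    have h1 : ‖χ x • H x‖ ≤ K := by
      rw [norm_smul, Real.norm_of_nonneg (hχ0 x)]
      nlinarith [hχ0 x, hχ1 x, hK x, norm_nonneg (H x)]
    have h2 := norm_le_norm_add_norm_sub' x (χ x • H x)
    rw [← dist_eq_norm] at h2
    have h3 := hd.trans_le (min_le_left _ _)
    simp only [Pi.smul_apply'] at h3
    linarith
  have hχx : χ x = 1 := by
    have : min 1 (K + 2 - ‖x‖) = 1 := min_eq_left (by linarith)
    simp [χ, this]
  have h4 : δ ≤ dist (H x) x := hx₀ (by simpa using hxK)
  have h5 := hd.trans_le (min_le_right _ _)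
  simp only [Pi.smul_apply', hχx, one_smul] at h5
  rw [dist_comm] at h5
  linarith

end NoRetraction

/-- Brouwer's fixed point theorem for a cube. -/
theorem exists_fixedPoint_of_mapsTo_cube {n : ℕ} {F : (Fin n → ℝ) → (Fin n → ℝ)}
    (hF : Continuous F) {R : ℝ} (hR : 0 ≤ R)
    (hmaps : ∀ y, (∀ i, |y i| ≤ R) → ∀ i, |F y i| ≤ R) :
    ∃ y, F y = y ∧ ∀ i, |y i| ≤ R := by
  -- Clamping to the cube makes `F ∘ c` bounded; its fixed points lie in the cube, where `c` is the
  -- identity.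
  let c : (Fin n → ℝ) → (Fin n → ℝ) := fun y i => max (-R) (min R (y i))
  have hc : Continuous c := by fun_prop
  have hcR : ∀ y i, |c y i| ≤ R := fun y i =>
    abs_le.2 ⟨le_max_left _ _, max_le (by linarith) (min_le_left _ _)⟩
  let e := EuclideanSpace.equiv (Fin n) ℝ
  obtain ⟨x, hx⟩ := exists_fixedPoint_of_continuous_of_bounded
    (H := fun x : EuclideanSpace ℝ (Fin n) => e.symm (F (c (e x)))) (K := √(∑ _i : Fin n, R ^ 2))
    (by fun_prop) fun x => by
      rw [EuclideanSpace.norm_eq]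
      refine Real.sqrt_le_sqrt (Finset.sum_le_sum fun i _ => ?_)
      exact pow_le_pow_left₀ (norm_nonneg _) (hmaps _ (hcR _) i) 2
  have hx' : F (c (e x)) = e x := by
    simpa using congrArg e hx
  have hb : ∀ i, |e x i| ≤ R := fun i => hx' ▸ hmaps _ (hcR _) i
  have hce : c (e x) = e x := by
    ext i
    have := abs_le.1 (hb i)
    simp [c, this.1, this.2]
  exact ⟨e x, by rwa [hce] at hx', hb⟩

/-! ### Tensor products and the reduced equation. -/

namespace SquareTensor

variable {k n : ℕ}

theorem prod_ofMatrix_apply (Q : Matrix (Fin n) (Fin n) ℝ) (B : SquareTensor (k + 1) n)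
    (idx : Fin (1 * k + 1) → Fin n) :
    prod (ofMatrix Q) B idx = ∑ l : Fin n, Q (idx 0) l *
      B (Fin.cons l fun s : Fin k => idx (finProdFinEquiv ((0 : Fin 1), s)).succ) := by
  unfold prod
  rw [← (Equiv.funUnique (Fin 1) (Fin n)).symm.sum_comp]
  refine Finset.sum_congr rfl fun l _ => ?_
  simp only [Finset.univ_unique, Finset.prod_singleton]
  rfl

theorem apply_prod_ofMatrix (Q : Matrix (Fin n) (Fin n) ℝ) (B : SquareTensor (k + 1) n)
    (x : Fin n → ℝ) : apply (prod (ofMatrix Q) B) x = Q.mulVec (apply B x) := by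
  let e : Fin k ≃ Fin (1 * k) := (Equiv.uniqueProd (Fin k) (Fin 1)).symm.trans finProdFinEquiv
  ext i
  unfold apply
  simp only [Matrix.mulVec, dotProduct, prod_ofMatrix_apply, Fin.cons_zero, Fin.cons_succ,
    Finset.mul_sum, Finset.sum_mul]
  rw [Finset.sum_comm]
  refine Finset.sum_congr rfl fun l _ => ?_
  rw [← (Equiv.arrowCongr e (Equiv.refl (Fin n))).sum_comp]
  refine Finset.sum_congr rfl fun j _ => ?_
  have h1 : ∀ s : Fin k, finProdFinEquiv ((0 : Fin 1), s) = e s := fun s => rfl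
  rw [← e.prod_comp]
  simp [h1, Equiv.arrowCongr, mul_assoc]

theorem apply_unit (x : Fin n → ℝ) (i : Fin n) :
    apply (unit (k + 1) n) x i = x i ^ k := by
  unfold apply
  rw [Finset.sum_eq_single fun _ => i]
  · have : ∀ s : Fin (k + 1), (Fin.cons i fun _ => i : Fin (k + 1) → Fin n) s = i :=
      Fin.cases rfl fun _ => rfl
    simp [unit, this]
  · intro j _ hj
    rw [unit, if_neg, zero_mul]
    intro h
    exact hj (funext fun t => by simpa using h t.succ 0)
  · simp

/-- Compare entries at the index `(i, j, …, j)`; `0 < k` ensures that `j` occurs in it. -/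
theorem mul_majorization_eq_one {Q : Matrix (Fin n) (Fin n) ℝ} {A : SquareTensor (k + 1) n}
    (hk : 0 < k) (hQ : IsLeftInverse (ofMatrix Q) A) : Q * majorization A = 1 := by
  ext i j
  have h := congrFun hQ (Fin.cons i fun _ => j)
  rw [prod_ofMatrix_apply] at h
  simp only [Fin.cons_zero, Fin.cons_succ] at h
  rw [Matrix.mul_apply]
  refine h.trans ?_
  rw [unit, Matrix.one_apply]
  by_cases hij : i = j
  · subst hij
    have : ∀ s : Fin (1 * k + 1), (Fin.cons i fun _ => i : Fin (1 * k + 1) → Fin n) s = i :=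
      Fin.cases rfl fun _ => rfl
    simp [this]
  · rw [if_neg, if_neg hij]
    intro h'
    exact hij (by simpa using h' 0 (Fin.succ ⟨0, by simpa using hk⟩))

theorem abs_apply_le (C : SquareTensor (k + 1) n) {u : Fin n → ℝ} {s : ℝ} (hs : 0 ≤ s)
    (hu : ∀ i, |u i| ≤ s) (i : Fin n) : |apply C u i| ≤ inftyNorm C * s ^ k := by
  calc |apply C u i|
      ≤ ∑ j : Fin k → Fin n, |C (Fin.cons i j : Fin (k + 1) → Fin n) * ∏ t, u (j t)| :=
        Finset.abs_sum_le_sum_abs _ _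
    _ ≤ ∑ j : Fin k → Fin n, |C (Fin.cons i j : Fin (k + 1) → Fin n)| * s ^ k := by
        refine Finset.sum_le_sum fun j _ => ?_
        rw [abs_mul, Finset.abs_prod]
        refine mul_le_mul_of_nonneg_left ?_ (abs_nonneg _)
        simpa using Finset.prod_le_prod (s := Finset.univ) (fun t _ => abs_nonneg (u (j t))) fun t _ => hu (j t)
    _ = (∑ j : Fin k → Fin n, |C (Fin.cons i j : Fin (k + 1) → Fin n)|) * s ^ k :=
        (Finset.sum_mul ..).symm
    _ ≤ inftyNorm C * s ^ k := by
        refine mul_le_mul_of_nonneg_right ?_ (by positivity)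
        exact le_ciSup (f := fun i => ∑ j : Fin k → Fin n, |C (Fin.cons i j : Fin (k + 1) → Fin n)|)
          (Set.finite_range _).bddAbove i

theorem continuous_apply (C : SquareTensor (k + 1) n) : Continuous (apply C) := by
  unfold apply
  fun_prop

/-- The fixed point form of the equation: if `‖C‖_∞ < 1` and `k` is odd, then
`x_i ^ k + (C |x| ^ k)_i = c_i` is solvable. -/
theorem exists_pow_add_apply_abs_eq {C : SquareTensor (k + 1) n} (hk : Odd k)
    (hC : inftyNorm C < 1) (c : Fin n → ℝ) :
    ∃ x : Fin n → ℝ, ∀ i, x i ^ k + apply C (fun i => |x i|) i = c i := by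
  have hk0 : k ≠ 0 := hk.pos.ne'
  let ρ : ℝ → ℝ := fun t => |t| ^ (k⁻¹ : ℝ)
  have hρ0 : ∀ t, 0 ≤ ρ t := fun t => by positivity
  have hρk : ∀ t, ρ t ^ k = |t| := fun t => Real.rpow_inv_natCast_pow (abs_nonneg t) hk0
  have hρc : Continuous ρ := continuous_abs.rpow_const fun _ => Or.inr (by positivity)
  -- The solution of `‖c‖ + ‖C‖_∞ R = R`, which makes the cube invariant.
  set R := ‖c‖ / (1 - inftyNorm C) with hRdef
  have h1 : 0 < 1 - inftyNorm C := by linarith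
  have hR : 0 ≤ R := by positivity
  have hRc : ‖c‖ + inftyNorm C * R = R := by
    have : R * (1 - inftyNorm C) = ‖c‖ := div_mul_cancel₀ _ h1.ne'
    linarith
  obtain ⟨y, hy, -⟩ := exists_fixedPoint_of_mapsTo_cube
    (F := fun y => c - apply C fun i => ρ (y i))
    (continuous_const.sub ((continuous_apply C).comp (by fun_prop))) hR fun y hy i => by
      have h2 := abs_apply_le C (hρ0 R) (u := fun i => ρ (y i)) (fun j => by
        rw [abs_of_nonneg (hρ0 _)]
        exact Real.rpow_le_rpow (abs_nonneg _) ((hy j).trans (le_abs_self R)) (by positivity)) i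
      rw [hρk, abs_of_nonneg hR] at h2
      have h3 : |c i| ≤ ‖c‖ := norm_le_pi_norm c i
      exact (abs_sub _ _).trans (by linarith)
  -- Oddness of `k` supplies roots of negative numbers.
  have hroot : ∀ t : ℝ, ∃ x : ℝ, x ^ k = t ∧ |x| = ρ t := fun t => by
    rcases le_total 0 t with ht | ht
    · exact ⟨ρ t, by rw [hρk, abs_of_nonneg ht], abs_of_nonneg (hρ0 t)⟩
    · exact ⟨-ρ t, by rw [hk.neg_pow, hρk, abs_of_nonpos ht, neg_neg],
        by rw [abs_neg, abs_of_nonneg (hρ0 t)]⟩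
  choose σ hσ hσρ using hroot
  refine ⟨fun i => σ (y i), fun i => ?_⟩
  simp only [hσ, hσρ]
  have := congrFun hy i
  simp only [Pi.sub_apply] at this
  linarith

end SquareTensor

theorem mainTheorem3 (m n : ℕ) (hp : Even (m + 1))
    (A B : SquareTensor (m + 1) n)
    (hA : SquareTensor.IsUniqueLeftInverse
      (SquareTensor.ofMatrix (SquareTensor.majorization A)⁻¹) A)
    (hAB : SquareTensor.inftyNorm
      (SquareTensor.prod (SquareTensor.ofMatrix (SquareTensor.majorization A)⁻¹) B) < 1)
    (b : Fin n → ℝ) :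
    ∃ x : Fin n → ℝ, SquareTensor.apply A x + SquareTensor.apply B (fun i => |x i|) = b := by
  have hm : Odd m := by
    rw [← Nat.not_even_iff_odd]
    exact fun h => by simp [h, Nat.even_add_one] at hp
  have hQM := SquareTensor.mul_majorization_eq_one hm.pos hA.1
  have hMQ := mul_eq_one_comm.1 hQM
  set M := SquareTensor.majorization A
  obtain ⟨x, hx⟩ := SquareTensor.exists_pow_add_apply_abs_eq
    (by rwa [one_mul]) hAB (M⁻¹.mulVec b)
  refine ⟨x, ?_⟩
  have hAx : M⁻¹.mulVec (SquareTensor.apply A x) = fun i => x i ^ (1 * m) := by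
    rw [← SquareTensor.apply_prod_ofMatrix, hA.1]
    exact funext (SquareTensor.apply_unit x)
  have h : M⁻¹.mulVec (SquareTensor.apply A x + SquareTensor.apply B fun i => |x i|) =
      M⁻¹.mulVec b := by
    rw [Matrix.mulVec_add, hAx, ← SquareTensor.apply_prod_ofMatrix]
    exact funext hx
  have h' := congrArg M.mulVec h
  rwa [Matrix.mulVec_mulVec, Matrix.mulVec_mulVec, hMQ, Matrix.one_mulVec, Matrix.one_mulVec] at h'
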